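/- Let $0<s<1$ and $\epsilon=\frac{1-s}{1+s}$. Let $\mathcal X^s_{\rm hol}$ be the space of entire functions $f$ with $\int_{\mathbb C}|f(z)|^2e^{sx^2-\frac1s y^2}\,dx\,dy<\infty$ ($z=x+iy$), with the inner product of $L^2(\mathbb C,e^{sx^2-\frac1sy^2}dx\,dy)$, and let $\mathcal H_{\rm hol}$ be the Bargmann space of entire functions in $L^2(\mathbb C,\pi^{-1}e^{-|z|^2}dx\,dy)$, with the inner product of that space. Let $$H_n(z)=n!\sum_{m=0}^{\lfloor n/2\rfloor}\frac{(-1)^m(2z)^{n-2m}}{m!\,(n-2m)!},\qquad b_n(s)=\frac{\pi\sqrt s}{1-s}\Big(2\,\frac{1+s}{1-s}\Big)^n n!,\qquad h_{s,n}(z)=e^{-z^2/2}\,\frac{H_n(z)}{\sqrt{b_n(s)}},\qquad \Phi_n(z)=\frac{z^n}{\sqrt{n!}}$$ for $n=0,1,2,\dots$, and let $$A(z,\bar w)=\Big(\frac{1-s}{\pi\sqrt s}\Big)^{1/2}\exp\Big[\sqrt{2\epsilon}\,z\bar w-\tfrac12(\epsilon z^2+\bar w^2)\Big],\qquad z,w\in\mathbb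 C.$$ Then $\mathcal X^s_{\rm hol}$ and $\mathcal H_{\rm hol}$ are Hilbert spaces, $(h_{s,n})_{n\ge0}$ is an orthonormal basis of $\mathcal X^s_{\rm hol}$, and $(\Phi_n)_{n\ge0}$ is an orthonormal basis of $\mathcal H_{\rm hol}$. For all $f\in\mathcal X^s_{\rm hol}$, $g\in\mathcal H_{\rm hol}$ the integrals $$(Af)(z)=\int_{\mathbb C}A(z,\bar w)\,f(w)\,e^{su^2-\frac1sv^2}\,du\,dv\quad(w=u+iv),\qquad (Wg)(w)=\int_{\mathbb C}\overline{A(z,\bar w)}\,g(z)\,e^{-|z|^2}\,\frac{dx\,dy}{\pi}\quad(z=x+iy)$$ converge absolutely for every $z\in\mathbb C$ and every $w\in\mathbb C$, respectively. The operator $A$ is a unitary map from $\mathcal X^s_{\rm hol}$ onto $\mathcal H_{\rm hol}$, $A h_{s,n}=\Phi_n$ for every $n\ge0$, and $A^{-1}=W$. -/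

import Mathlib

open MeasureTheory
open scoped ComplexConjugate Nat

noncomputable section

/-- The linear space of entire functions that are square integrable with respect to `μ`. -/
def entireL2Submodule (μ : Measure ℂ) : Submodule ℂ (ℂ → ℂ) where
  carrier := {f | Differentiable ℂ f ∧ MemLp f 2 μ}
  add_mem' := fun hf hg => ⟨hf.1.add hg.1, hf.2.add hg.2⟩
  zero_mem' := ⟨differentiable_const 0, MemLp.zero⟩
  smul_mem' := fun c _ hf => ⟨hf.1.const_smul c, hf.2.const_smul c⟩

/-- The space of entire functions in `L²(ℂ, μ)`, as a type of its own, so that it carries the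
`L²` structure defined below and not the topology of pointwise convergence of `ℂ → ℂ`. -/
def EntireL2 (μ : Measure ℂ) : Type := entireL2Submodule μ

namespace EntireL2

variable {μ : Measure ℂ}

instance : AddCommGroup (EntireL2 μ) := inferInstanceAs (AddCommGroup (entireL2Submodule μ))

instance : Module ℂ (EntireL2 μ) := inferInstanceAs (Module ℂ (entireL2Submodule μ))

instance : CoeFun (EntireL2 μ) (fun _ => ℂ → ℂ) := ⟨fun f => f.1⟩

theorem ext_fun {f g : EntireL2 μ} (h : ∀ z, f z = g z) : f = g := Subtype.ext (funext h)

theorem differentiable (f : EntireL2 μ) : Differentiable ℂ (f : ℂ → ℂ) := f.2.1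

theorem memLp (f : EntireL2 μ) : MemLp (f : ℂ → ℂ) 2 μ := f.2.2

theorem add_apply (f g : EntireL2 μ) (z : ℂ) : (f + g) z = f z + g z := rfl

theorem smul_apply (c : ℂ) (f : EntireL2 μ) (z : ℂ) : (c • f) z = c * f z := rfl

theorem zero_apply (z : ℂ) : (0 : EntireL2 μ) z = 0 := rfl

theorem integrable_conj_mul (f g : EntireL2 μ) :
    Integrable (fun z => conj (f z) * g z) μ :=
  MemLp.integrable_mul (p := 2) (q := 2) f.memLp.star g.memLp

/-- The `L²(ℂ, μ)` inner product, linear in the second argument (Mathlib's convention). -/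
instance instInner : Inner ℂ (EntireL2 μ) := ⟨fun f g => ∫ z, conj (f z) * g z ∂μ⟩

theorem inner_def (f g : EntireL2 μ) : inner ℂ f g = ∫ z, conj (f z) * g z ∂μ := rfl

theorem inner_self_eq (f : EntireL2 μ) :
    inner ℂ f f = ((∫ z, ‖f z‖ ^ 2 ∂μ : ℝ) : ℂ) := by
  rw [inner_def, ← integral_complex_ofReal]
  congr 1
  funext z
  rw [Complex.conj_mul']
  push_cast
  rfl

/-- The inner product axioms; definiteness needs that nonempty open sets have positive measure. -/
instance instCore [μ.IsOpenPosMeasure] : InnerProductSpace.Core ℂ (EntireL2 μ) where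
  conj_inner_symm := fun f g => by
    rw [inner_def, inner_def, ← integral_conj]
    congr 1
    funext z
    simp [mul_comm]
  re_inner_nonneg := fun f => by
    rw [inner_self_eq]
    exact integral_nonneg (fun z => by positivity)
  add_left := fun f g h => by
    simp only [inner_def]
    rw [← integral_add (integrable_conj_mul f h) (integrable_conj_mul g h)]
    congr 1
    funext z
    rw [add_apply, map_add, add_mul]
  smul_left := fun f g c => by
    simp only [inner_def]
    rw [← integral_const_mul]
    congr 1
    funext z
    rw [smul_apply, map_mul, mul_assoc]
  definite := fun f hf => by
    rw [inner_self_eq, Complex.ofReal_eq_zero,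
      integral_eq_zero_iff_of_nonneg (fun z => by positivity)
        (f.memLp.integrable_norm_pow two_ne_zero)] at hf
    have h0 : (f : ℂ → ℂ) =ᵐ[μ] fun _ => 0 := by
      filter_upwards [hf] with z hz
      simpa using hz
    have h1 := (Continuous.ae_eq_iff_eq μ f.differentiable.continuous continuous_const).1 h0
    exact ext_fun (fun z => congrFun h1 z)

/-- The norm `‖f‖ = (∫ |f|² dμ)^(1/2)` that comes from the inner product. -/
instance instNormedAddCommGroup [μ.IsOpenPosMeasure] : NormedAddCommGroup (EntireL2 μ) :=
  InnerProductSpace.Core.toNormedAddCommGroup (𝕜 := ℂ)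

instance instInnerProductSpace [μ.IsOpenPosMeasure] : InnerProductSpace ℂ (EntireL2 μ) :=
  InnerProductSpace.ofCore instCore.toCore

end EntireL2

theorem isOpenPosMeasure_withDensity_ofReal {ρ : ℂ → ℝ} (hc : Continuous ρ) (hp : ∀ z, 0 < ρ z) :
    ((volume : Measure ℂ).withDensity (fun z => ENNReal.ofReal (ρ z))).IsOpenPosMeasure := by
  refine (withDensity_absolutelyContinuous' (μ := (volume : Measure ℂ))
    (ENNReal.measurable_ofReal.comp hc.measurable).aemeasurable
    (Filter.Eventually.of_forall fun z => ?_)).isOpenPosMeasure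
  simpa using hp z

/-- The measure `exp (s x² - y² / s) dx dy` on `ℂ`, where `z = x + i y`. -/
def measureX (s : ℝ) : Measure ℂ :=
  volume.withDensity (fun z => ENNReal.ofReal (Real.exp (s * z.re ^ 2 - 1 / s * z.im ^ 2)))

/-- The Bargmann measure `π⁻¹ exp (-|z|²) dx dy` on `ℂ`. -/
def bargmannMeasure : Measure ℂ :=
  volume.withDensity (fun z => ENNReal.ofReal (Real.pi⁻¹ * Real.exp (-‖z‖ ^ 2)))

instance instIsOpenPosMeasureX (s : ℝ) : (measureX s).IsOpenPosMeasure :=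
  isOpenPosMeasure_withDensity_ofReal (by fun_prop) (fun z => Real.exp_pos _)

instance instIsOpenPosMeasureBargmann : bargmannMeasure.IsOpenPosMeasure :=
  isOpenPosMeasure_withDensity_ofReal (by fun_prop) (fun z => by positivity)

/-- The space `X^s_hol` of entire functions in `L²(ℂ, exp (s x² - y² / s) dx dy)`. -/
abbrev XHol (s : ℝ) : Type := EntireL2 (measureX s)

/-- The Bargmann space `H_hol` of entire functions in `L²(ℂ, π⁻¹ exp (-|z|²) dx dy)`. -/
abbrev BargmannSpace : Type := EntireL2 bargmannMeasure

/-- The (physicists') Hermite polynomial `H_n` as a function of a complex variable. -/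
def hermiteH (n : ℕ) (z : ℂ) : ℂ :=
  (n ! : ℂ) * ∑ m ∈ Finset.range (n / 2 + 1),
    (-1) ^ m * (2 * z) ^ (n - 2 * m) / ((m ! : ℂ) * ((n - 2 * m)! : ℂ))

/-- The normalization constant `b_n(s)` of the Hermite polynomials. -/
def hermiteB (s : ℝ) (n : ℕ) : ℝ :=
  Real.pi * √s / (1 - s) * (2 * ((1 + s) / (1 - s))) ^ n * (n ! : ℝ)

/-- The function `h_{s,n} = exp (-z² / 2) H_n(z) / √(b_n(s))`. -/
def basisH (s : ℝ) (n : ℕ) (z : ℂ) : ℂ :=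
  Complex.exp (-z ^ 2 / 2) * (hermiteH n z / (√(hermiteB s n) : ℂ))

/-- The Fock-Bargmann basis functions `Φ_n(z) = z^n / √(n!)`. -/
def basisPhi (n : ℕ) (z : ℂ) : ℂ := z ^ n / (√(n ! : ℝ) : ℂ)

/-- `ε = (1 - s) / (1 + s)`. -/
def epsilonOf (s : ℝ) : ℝ := (1 - s) / (1 + s)

/-- The Gaussian kernel as a function of its two arguments; the second argument is `conj w` in
the integral operators below. -/
def kernelA (s : ℝ) (z v : ℂ) : ℂ :=
  (√((1 - s) / (Real.pi * √s)) : ℂ) *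
    Complex.exp ((√(2 * epsilonOf s) : ℂ) * z * v - ((epsilonOf s : ℂ) * z ^ 2 + v ^ 2) / 2)

/-- The integral operator `A`, with kernel `A(z, conj w)`. -/
def operatorA (s : ℝ) (f : ℂ → ℂ) (z : ℂ) : ℂ :=
  ∫ w, kernelA s z (conj w) * f w ∂(measureX s)

/-- The integral operator `W`, with kernel `conj (A(z, conj w))`, against the Bargmann measure. -/
def operatorW (s : ℝ) (g : ℂ → ℂ) (w : ℂ) : ℂ :=
  ∫ z, conj (kernelA s z (conj w)) * g z ∂bargmannMeasure

end

/-! Both spaces have reproducing kernels, and the kernel of $A$ links them. Let $R_w$ (`kernelX`)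
and $E_z=e^{\bar z\,\cdot}$ (`kernelBargmann`) be the reproducing vectors of $\mathcal X^s_{\rm
hol}$ and $\mathcal H_{\rm hol}$, and put $K_z=\overline{A(z,\bar\cdot)}\in\mathcal X^s_{\rm hol}$,
$Q_w=A(\cdot,\bar w)\in\mathcal H_{\rm hol}$, so that $(Af)(z)=\langle K_z,f\rangle$ and
$(Wg)(w)=\langle Q_w,g\rangle$. The families $(R_w,K_z)$ and $(Q_w,E_z)$ have the same Gram matrix.
Two blocks are Gaussian integrals, `integral_kernelA_mul_kernelA_measureX` and
`integral_kernelA_mul_kernelA_bargmannMeasure`; the mixed blocks follow from the reproducing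
property alone. Both families are total, so `exists_linearIsometryEquiv_of_gram_eq` yields a unitary
$U$ with $UR_w=Q_w$, $UK_z=E_z$. Then $(Uf)(z)=\langle E_z,Uf\rangle=\langle K_z,f\rangle=(Af)(z)$,
and likewise $U^{-1}=W$.

The Hermite generating function gives $A(z,v)=\sum_n h_{s,n}(v)\Phi_n(z)$ (`hasSum_kernelA`), which
identifies $U^{-1}\Phi_n$ as $h_{s,n}$. Orthonormality and completeness of the Hermite system are
thus carried over from the monomials. -/

/-! ### Entire functions against radial weights -/

/-- Cauchy's formula on the unit circle, for the coefficients of an entire power series. -/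
theorem integral_exp_neg_mul_comp_circle {G : ℂ → ℂ} {c : ℕ → ℂ}
    (hG : Differentiable ℂ G) (hc : ∀ z, HasSum (fun k => c k * z ^ k) (G z)) (n : ℕ) (w : ℂ) :
    ∫ θ in (0 : ℝ)..2 * Real.pi,
      Complex.exp (-(n * θ * Complex.I)) * G (Complex.exp (θ * Complex.I) * w) =
    2 * Real.pi * (c n * w ^ n) := by
  -- Scaling by `w` puts $w^k$ into the Taylor coefficients of `F`, so the contour is always the
  -- unit circle and `w = 0` is not special.
  set F : ℂ → ℂ := fun ζ => G (ζ * w) with hF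
  have hd : Differentiable ℂ F := hG.comp (differentiable_id.mul_const w)
  have h1 : HasFPowerSeriesAt F (cauchyPowerSeries F 0 (1 : NNReal)) 0 :=
    (hd.hasFPowerSeriesOnBall 0 one_pos).hasFPowerSeriesAt
  have h2 : HasFPowerSeriesAt F (FormalMultilinearSeries.ofScalars ℂ fun k => c k * w ^ k) 0 := by
    rw [hasFPowerSeriesAt_iff]
    refine Filter.Eventually.of_forall fun z => ?_
    have := hc (z * w)
    simp only [FormalMultilinearSeries.coeff_ofScalars, smul_eq_mul, zero_add, hF]
    refine this.congr_fun ?_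
    intro k
    rw [mul_pow]; ring
  have h3 := congrArg (fun p : FormalMultilinearSeries ℂ ℂ ℂ => p.coeff n)
    (h1.eq_formalMultilinearSeries h2)
  simp only [FormalMultilinearSeries.coeff_ofScalars] at h3
  rw [← h3, FormalMultilinearSeries.coeff]
  simp only [cauchyPowerSeries, circleIntegral, deriv_circleMap, circleMap, smul_eq_mul,
    ContinuousMultilinearMap.mkPiRing_apply]
  simp only [Pi.one_apply, Finset.prod_const_one, one_mul, NNReal.coe_one, Complex.ofReal_one,
    zero_add, sub_zero]
  rw [mul_inv, ← mul_assoc, mul_inv, show (2 * (Real.pi : ℂ)) * (2⁻¹ * (Real.pi : ℂ)⁻¹ * Complex.I⁻¹)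
    = Complex.I⁻¹ by field_simp, ← intervalIntegral.integral_const_mul]
  congr 1
  funext θ
  have he := Complex.exp_ne_zero (θ * Complex.I)
  rw [Complex.exp_neg, mul_assoc (n : ℂ), Complex.exp_nat_mul, hF]
  field_simp
  rw [one_div, inv_pow, mul_right_comm, mul_inv_cancel₀ (pow_ne_zero _ he), one_mul]

/-- A radial weight only sees the matching Taylor coefficient of an entire function. -/
theorem integral_conj_pow_mul_entire_mul_radial {G : ℂ → ℂ} {c : ℕ → ℂ}
    (hG : Differentiable ℂ G) (hc : ∀ z, HasSum (fun k => c k * z ^ k) (G z)) (n : ℕ)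
    {ρ : ℝ → ℝ} (hρ : Continuous ρ)
    (hi : Integrable (fun w : ℂ => conj w ^ n * G w * (ρ ‖w‖ : ℂ))) :
    ∫ w : ℂ, conj w ^ n * G w * (ρ ‖w‖ : ℂ) =
      c n * ((∫ w : ℂ, ‖w‖ ^ (2 * n) * ρ ‖w‖ : ℝ) : ℂ) := by
  set f : ℂ → ℂ := fun w => conj w ^ n * G w * (ρ ‖w‖ : ℂ) with hf
  have hGc := hG.continuous
  have hfc : Continuous f := by
    have := Complex.continuous_conj
    fun_prop
  have hmp (θ : ℝ) : MeasurePreserving (fun w : ℂ => Complex.exp (θ * Complex.I) * w) := by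
    have h := (rotation (Circle.exp θ)).measurePreserving
    have e : ⇑(rotation (Circle.exp θ)) = fun w : ℂ => Complex.exp (θ * Complex.I) * w := by
      funext w
      simp [rotation_apply]
    rwa [e] at h
  have hint (θ : ℝ) : ∫ w, f (Complex.exp (θ * Complex.I) * w) = ∫ w, f w := by
    have h := (rotation (Circle.exp θ)).measurePreserving.integral_comp
      (rotation (Circle.exp θ)).toHomeomorph.measurableEmbedding f
    simpa [rotation_apply] using h
  have hint' (θ : ℝ) : ∫ w, ‖f (Complex.exp (θ * Complex.I) * w)‖ = ∫ w, ‖f w‖ := by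
    have h := (rotation (Circle.exp θ)).measurePreserving.integral_comp
      (rotation (Circle.exp θ)).toHomeomorph.measurableEmbedding fun w => ‖f w‖
    simpa [rotation_apply] using h
  have hprod : Integrable (Function.uncurry fun (θ : ℝ) (w : ℂ) =>
      f (Complex.exp (θ * Complex.I) * w))
      ((volume.restrict (Set.Ioc 0 (2 * Real.pi))).prod volume) := by
    rw [integrable_prod_iff (by
      refine Continuous.aestronglyMeasurable ?_
      unfold Function.uncurry
      fun_prop)]
    refine ⟨Filter.Eventually.of_forall fun θ => ?_, ?_⟩
    · exact (hmp θ).integrable_comp_of_integrable hi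
    · simp only [Function.uncurry, hint']
      exact integrable_const _
  -- Lebesgue measure is rotation invariant: integrating over `w` first gives $2\pi\int f$,
  -- integrating over `θ` first gives Cauchy's formula on each circle.
  have hswap := integral_integral_swap hprod
  simp only [hint] at hswap
  have hpi : (0 : ℝ) ≤ 2 * Real.pi := by positivity
  have hinner (w : ℂ) : ∫ θ in Set.Ioc 0 (2 * Real.pi), f (Complex.exp (θ * Complex.I) * w) =
      2 * Real.pi * (c n * ((‖w‖ ^ (2 * n) * ρ ‖w‖ : ℝ) : ℂ)) := by
    rw [← intervalIntegral.integral_of_le hpi]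
    have key := integral_exp_neg_mul_comp_circle hG hc n w
    calc ∫ θ in (0 : ℝ)..2 * Real.pi, f (Complex.exp (θ * Complex.I) * w)
        = ∫ θ in (0 : ℝ)..2 * Real.pi, (conj w ^ n * (ρ ‖w‖ : ℂ)) *
          (Complex.exp (-(n * θ * Complex.I)) * G (Complex.exp (θ * Complex.I) * w)) := by
          congr 1
          funext θ
          have h1 : conj (Complex.exp (θ * Complex.I)) ^ n = Complex.exp (-(n * θ * Complex.I)) := by
            rw [← Complex.exp_conj, ← Complex.exp_nat_mul]
            congr 1
            simp
            ring
          simp only [hf, map_mul, norm_mul, Complex.norm_exp_ofReal_mul_I, one_mul, mul_pow, h1]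
          ring
      _ = _ := by
          rw [intervalIntegral.integral_const_mul, key]
          have : conj w ^ n * w ^ n = ((‖w‖ ^ (2 * n) : ℝ) : ℂ) := by
            rw [← mul_pow, Complex.conj_mul', pow_mul]
            push_cast
            rfl
          rw [Complex.ofReal_mul, ← this]
          ring
  simp only [hinner, integral_const_mul, integral_const, measureReal_restrict_apply_univ,
    Real.volume_real_Ioc, sub_zero, max_eq_left hpi, integral_complex_ofReal] at hswap
  have h2 : (2 * (Real.pi : ℂ)) ≠ 0 := by
    simp [Real.pi_ne_zero]
  refine mul_left_cancel₀ h2 (Eq.trans ?_ hswap)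
  rw [Complex.real_smul]
  push_cast
  rfl

/-! ### Gaussian integrals over the plane -/

theorem integral_norm_pow_mul_exp_neg_sq (n : ℕ) :
    ∫ w : ℂ, ‖w‖ ^ (2 * n) * Real.exp (-‖w‖ ^ 2) = Real.pi * n ! := by
  have h := Complex.integral_rpow_mul_exp_neg_rpow (p := 2) (q := 2 * n) (by norm_num)
    (by have : (0 : ℝ) ≤ n := n.cast_nonneg
        linarith)
  rw [show ((2 * n + 2 : ℝ) / 2) = n + 1 by ring, Real.Gamma_nat_eq_factorial] at h
  rw [show 2 * Real.pi / 2 = Real.pi by ring] at h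
  rw [← h]
  congr 1
  funext w
  rw [← Real.rpow_natCast, Real.rpow_two]
  push_cast
  rfl

theorem integrable_norm_pow_mul_exp_neg_sq (n : ℕ) :
    Integrable fun w : ℂ => ‖w‖ ^ (2 * n) * Real.exp (-‖w‖ ^ 2) := by
  -- A non-integrable function has Bochner integral 0, but this one has the nonzero integral
  -- $\pi\,n!$.
  by_contra h
  have := integral_undef h
  rw [integral_norm_pow_mul_exp_neg_sq] at this
  have : Real.pi * n ! ≠ 0 := by positivity
  contradiction

theorem integrable_cexp_gaussian {p q : ℝ} (hp : 0 < p) (hq : 0 < q) (a b k : ℂ) :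
    Integrable fun w : ℂ =>
      Complex.exp (-p * w.re ^ 2 + a * w.re + (-q * w.im ^ 2 + b * w.im) + k) := by
  have h := (integrable_cexp_quadratic (b := p) (by simpa) a 0).mul_prod
    (integrable_cexp_quadratic (b := q) (by simpa) b k)
  have h' := (Complex.volume_preserving_equiv_real_prod.integrable_comp_emb
    Complex.measurableEquivRealProd.measurableEmbedding).2 h
  refine h'.congr (Filter.Eventually.of_forall fun w => ?_)
  simp only [Function.comp, Complex.measurableEquivRealProd_apply]
  rw [← Complex.exp_add]
  congr 1
  ring

theorem integral_cexp_gaussian {p q : ℝ} (hp : 0 < p) (hq : 0 < q) (a b k : ℂ) :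
    ∫ w : ℂ, Complex.exp (-p * w.re ^ 2 + a * w.re + (-q * w.im ^ 2 + b * w.im) + k) =
      (Real.pi / √(p * q) : ℝ) * Complex.exp (a ^ 2 / (4 * p) + b ^ 2 / (4 * q) + k) := by
  have h1 := integral_cexp_quadratic (b := -p) (by simpa) a 0
  have h2 := integral_cexp_quadratic (b := -q) (by simpa) b k
  have h := integral_prod_mul (μ := volume) (ν := volume)
    (fun x : ℝ => Complex.exp (-p * x ^ 2 + a * x + 0))
    (fun x : ℝ => Complex.exp (-q * x ^ 2 + b * x + k))
  rw [h1, h2] at h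
  have h' := Complex.volume_preserving_equiv_real_prod.integral_comp
    Complex.measurableEquivRealProd.measurableEmbedding
    (fun z : ℝ × ℝ => Complex.exp (-p * z.1 ^ 2 + a * z.1 + 0) *
      Complex.exp (-q * z.2 ^ 2 + b * z.2 + k))
  rw [← Measure.volume_eq_prod] at h
  rw [h] at h'
  simp only [Complex.measurableEquivRealProd_apply] at h'
  have hl : (fun w : ℂ => Complex.exp (-p * w.re ^ 2 + a * w.re + (-q * w.im ^ 2 + b * w.im) + k))
      = fun w : ℂ => Complex.exp (-p * w.re ^ 2 + a * w.re + 0) *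
      Complex.exp (-q * w.im ^ 2 + b * w.im + k) := by
    funext w
    rw [← Complex.exp_add]
    congr 1
    ring
  rw [hl, h']
  have hs : ∀ {r : ℝ}, 0 < r → ((Real.pi : ℂ) / -(-r : ℂ)) ^ (1 / 2 : ℂ) = (√(Real.pi / r) : ℝ) := by
    intro r hr
    rw [neg_neg, Real.sqrt_eq_rpow, Complex.ofReal_cpow (by positivity)]
    push_cast
    rfl
  have hm : √(Real.pi / p) * √(Real.pi / q) = Real.pi / √(p * q) := by
    rw [← Real.sqrt_mul (by positivity), div_mul_div_comm, Real.sqrt_div (by positivity),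
      Real.sqrt_mul_self Real.pi_pos.le]
  rw [hs hp, hs hq, mul_mul_mul_comm, ← Complex.ofReal_mul, hm, ← Complex.exp_add]
  congr 2
  have : (p : ℂ) ≠ 0 := by exact_mod_cast hp.ne'
  have : (q : ℂ) ≠ 0 := by exact_mod_cast hq.ne'
  field_simp
  ring

/-! ### Total families and unitary maps -/

/-- Totality is expressed by vanishing inner products because, for reproducing vectors, these are
the point values of `x`. -/
theorem denseRange_linearCombination_of_total {ι E : Type*} [NormedAddCommGroup E]
    [InnerProductSpace ℂ E] [CompleteSpace E] {v : ι → E}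
    (hv : ∀ x, (∀ i, inner ℂ (v i) x = 0) → x = 0) :
    DenseRange (Finsupp.linearCombination ℂ v) := by
  have h1 : (LinearMap.range (Finsupp.linearCombination ℂ v)).topologicalClosure = ⊤ := by
    rw [Submodule.topologicalClosure_eq_top_iff, Submodule.eq_bot_iff]
    intro x hx
    refine hv x fun i => (Submodule.mem_orthogonal _ _).1 hx _ ⟨Finsupp.single i 1, ?_⟩
    simp
  rw [← Submodule.dense_iff_topologicalClosure_eq_top] at h1
  exact h1

theorem norm_sq_linearCombination {ι E : Type*} [NormedAddCommGroup E] [InnerProductSpace ℂ E]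
    (v : ι → E) (x : ι →₀ ℂ) : ‖Finsupp.linearCombination ℂ v x‖ ^ 2 =
      (x.sum fun i a => x.sum fun j b => b * (conj a * inner ℂ (v i) (v j))).re := by
  rw [← inner_self_eq_norm_sq (𝕜 := ℂ), Finsupp.linearCombination_apply, Finsupp.sum_inner]
  simp only [Finsupp.inner_sum, inner_smul_left, inner_smul_right, RCLike.re_to_complex]

/-- Two total families with the same Gram matrix are related by a unitary map. -/
theorem exists_linearIsometryEquiv_of_gram_eq {ι E F : Type*}
    [NormedAddCommGroup E] [InnerProductSpace ℂ E] [CompleteSpace E]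
    [NormedAddCommGroup F] [InnerProductSpace ℂ F] [CompleteSpace F] (v : ι → E) (w : ι → F)
    (hv : ∀ x, (∀ i, inner ℂ (v i) x = 0) → x = 0) (hw : ∀ x, (∀ i, inner ℂ (w i) x = 0) → x = 0)
    (h : ∀ i j, inner ℂ (w i) (w j) = inner ℂ (v i) (v j)) :
    ∃ U : E ≃ₗᵢ[ℂ] F, ∀ i, U (v i) = w i := by
  have dv := denseRange_linearCombination_of_total hv
  have dw := denseRange_linearCombination_of_total hw
  have hnorm (x : ι →₀ ℂ) : ‖Finsupp.linearCombination ℂ w (LinearEquiv.refl ℂ _ x)‖ =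
      ‖Finsupp.linearCombination ℂ v x‖ := by
    rw [← sq_eq_sq₀ (norm_nonneg _) (norm_nonneg _), norm_sq_linearCombination,
      LinearEquiv.refl_apply, norm_sq_linearCombination]
    simp only [h]
  refine ⟨(LinearEquiv.refl ℂ (ι →₀ ℂ)).extendOfIsometry _ _ dv dw hnorm, fun i => ?_⟩
  have := LinearEquiv.extendOfIsometry_eq (LinearEquiv.refl ℂ (ι →₀ ℂ)) _ _ dv dw
    hnorm (Finsupp.single i 1)
  simpa using this

/-! ### Gaussian reproducing formula and densities -/

/-- This is the mean value property: only the constant Taylor coefficient survives a radial weight.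
-/
theorem integral_entire_mul_gaussian {G : ℂ → ℂ} (hG : Differentiable ℂ G) {c : ℝ} (hc : 0 < c)
    (hi : Integrable fun w : ℂ => G w * (Real.exp (-c * ‖w‖ ^ 2) : ℂ)) :
    ∫ w : ℂ, G w * (Real.exp (-c * ‖w‖ ^ 2) : ℂ) = (Real.pi / c : ℝ) * G 0 := by
  have hs (z : ℂ) := Complex.hasSum_taylorSeries_of_entire hG 0 z
  have h := integral_conj_pow_mul_entire_mul_radial hG
    (c := fun k => (k ! : ℂ)⁻¹ * iteratedDeriv k G 0)
    (fun z => (hs z).congr_fun fun k => by simp only [smul_eq_mul, sub_zero]; ring) 0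
    (ρ := fun r => Real.exp (-c * r ^ 2)) (by fun_prop) (by simpa using hi)
  have hg := GaussianFourier.integral_rexp_neg_mul_sq_norm (V := ℂ) hc
  simp only [Complex.finrank_real_complex, Nat.cast_ofNat, div_self (two_ne_zero (α := ℝ)),
    Real.rpow_one] at hg
  simp only [pow_zero, one_mul, mul_zero, hg] at h
  rw [h]
  simp [mul_comm]

/-- The Gaussian reproducing formula for entire functions. -/
theorem integral_exp_mul_entire_mul_gaussian {f : ℂ → ℂ} (hf : Differentiable ℂ f) {c : ℝ}
    (hc : 0 < c) (z : ℂ)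
    (hi : Integrable fun w : ℂ =>
      Complex.exp (c * z * conj w) * f w * (Real.exp (-c * ‖w‖ ^ 2) : ℂ)) :
    ∫ w : ℂ, Complex.exp (c * z * conj w) * f w * (Real.exp (-c * ‖w‖ ^ 2) : ℂ) =
      (Real.pi / c : ℝ) * f z := by
  -- With $w=u+z$ one has $cz\bar w-c|w|^2=-c|u|^2-cu\bar z$: apart from the radial weight the
  -- integrand is entire in $u$, with value $f(z)$ at $u=0$.
  have he : (fun u : ℂ => Complex.exp (c * z * conj (u + z)) * f (u + z) *
      (Real.exp (-c * ‖u + z‖ ^ 2) : ℂ)) = fun u : ℂ =>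
      (f (u + z) * Complex.exp (-(c * u * conj z))) * (Real.exp (-c * ‖u‖ ^ 2) : ℂ) := by
    funext u
    push_cast
    rw [← Complex.conj_mul', ← Complex.conj_mul', mul_right_comm, ← Complex.exp_add,
      mul_assoc (f _), ← Complex.exp_add, mul_comm]
    congr 2
    simp only [map_add]
    ring
  rw [← integral_add_right_eq_self _ z, he, integral_entire_mul_gaussian (by fun_prop) hc
    (by rw [← he]; exact hi.comp_add_right z)]
  simp

theorem integrable_withDensity_ofReal_iff {ρ : ℂ → ℝ} (hρ : Continuous ρ) (h0 : ∀ z, 0 ≤ ρ z)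
    {f : ℂ → ℂ} : Integrable f (volume.withDensity fun z => ENNReal.ofReal (ρ z)) ↔
      Integrable fun z => f z * (ρ z : ℂ) := by
  rw [integrable_withDensity_iff_integrable_smul' (by fun_prop) (by simp)]
  refine integrable_congr (Filter.Eventually.of_forall fun z => ?_)
  simp [ENNReal.toReal_ofReal (h0 z), mul_comm]

theorem integral_withDensity_ofReal {ρ : ℂ → ℝ} (hρ : Continuous ρ) (h0 : ∀ z, 0 ≤ ρ z)
    (f : ℂ → ℂ) : ∫ z, f z ∂(volume.withDensity fun z => ENNReal.ofReal (ρ z)) =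
      ∫ z, f z * (ρ z : ℂ) := by
  rw [integral_withDensity_eq_integral_toReal_smul (by fun_prop) (by simp)]
  congr 1
  funext z
  simp [ENNReal.toReal_ofReal (h0 z), mul_comm]

theorem memLp_two_of_integrable_conj_mul_self {μ : Measure ℂ} {f : ℂ → ℂ} (hf : Continuous f)
    (hi : Integrable (fun z => conj (f z) * f z) μ) : MemLp f 2 μ := by
  rw [memLp_two_iff_integrable_sq_norm hf.aestronglyMeasurable]
  refine hi.norm.congr (Filter.Eventually.of_forall fun z => ?_)
  simp [sq]

/-! ### Completeness from a reproducing kernel -/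

namespace EntireL2

variable {μ : Measure ℂ}

/-- The element of `EntireL2 μ` given by a square integrable entire function. -/
noncomputable def mk (f : ℂ → ℂ) (hf : Differentiable ℂ f) (hm : MemLp f 2 μ) : EntireL2 μ := ⟨f, hf, hm⟩

theorem mk_apply (f : ℂ → ℂ) (hf : Differentiable ℂ f) (hm : MemLp f 2 μ) (z : ℂ) :
    mk f hf hm z = f z := rfl

theorem sub_apply (f g : EntireL2 μ) (z : ℂ) : (f - g) z = f z - g z := rfl

variable [μ.IsOpenPosMeasure]

theorem eLpNorm_eq (f : EntireL2 μ) : eLpNorm (f : ℂ → ℂ) 2 μ = ENNReal.ofReal ‖f‖ := by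
  rw [f.memLp.eLpNorm_eq_integral_rpow_norm two_ne_zero ENNReal.ofNat_ne_top]
  congr 1
  have h : ‖f‖ ^ 2 = ∫ z, ‖f z‖ ^ 2 ∂μ := by
    rw [← inner_self_eq_norm_sq (𝕜 := ℂ), inner_self_eq]
    simp
  rw [← Real.sqrt_sq (norm_nonneg f), h, Real.sqrt_eq_rpow]
  simp

/-- A space of entire functions with a locally bounded reproducing kernel is complete. -/
theorem completeSpace_of_reproducing (R : ℂ → EntireL2 μ)
    (hR : ∀ z f, inner ℂ (R z) f = f z) (hc : Continuous fun z => R z z) :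
    CompleteSpace (EntireL2 μ) := by
  have hnorm : Continuous fun z => ‖R z‖ := by
    have : (fun z => ‖R z‖) = fun z => √((R z z).re) := by
      funext z
      rw [← hR z (R z), ← RCLike.re_to_complex, inner_self_eq_norm_sq, Real.sqrt_sq (norm_nonneg _)]
    rw [this]
    exact (Complex.continuous_re.comp hc).sqrt
  -- Geometric control makes the $L^2$ distances summable, which later turns pointwise convergence
  -- into $L^2$ convergence. The kernel bound makes the convergence locally uniform, so the limit is
  -- entire.
  refine Metric.complete_of_convergent_controlled_sequences (fun n => (1 / 2 : ℝ) ^ n)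
    (fun n => by positivity) fun u hu => ?_
  have hcau : CauchySeq u := Metric.cauchySeq_iff.2 fun ε hε => by
    obtain ⟨N, hN⟩ := exists_pow_lt_of_lt_one hε (by norm_num : (1 / 2 : ℝ) < 1)
    exact ⟨N, fun m hm n hn => (hu N m n hm hn).trans hN⟩
  have hbound (f g : EntireL2 μ) (z : ℂ) : dist (f z) (g z) ≤ ‖R z‖ * dist f g := by
    rw [dist_eq_norm, dist_eq_norm, ← sub_apply, ← hR z (f - g)]
    exact norm_inner_le_norm _ _
  have hpt (z : ℂ) : ∃ y, Filter.Tendsto (fun n => u n z) Filter.atTop (nhds y) := by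
    refine cauchySeq_tendsto_of_complete (Metric.cauchySeq_iff.2 fun ε hε => ?_)
    -- The `+ 1` keeps the denominator positive even if `R z` vanishes.
    obtain ⟨N, hN⟩ := Metric.cauchySeq_iff.1 hcau (ε / (‖R z‖ + 1)) (by positivity)
    refine ⟨N, fun m hm n hn => (hbound _ _ z).trans_lt ?_⟩
    have h1 := hN m hm n hn
    rw [lt_div_iff₀ (by positivity)] at h1
    nlinarith [dist_nonneg (x := u m) (y := u n), norm_nonneg (R z)]
  choose f hf using hpt
  have hloc : TendstoLocallyUniformlyOn (fun n => (u n : ℂ → ℂ)) f Filter.atTop Set.univ := by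
    rw [tendstoLocallyUniformlyOn_iff_forall_isCompact isOpen_univ]
    intro K _ hK
    refine UniformCauchySeqOn.tendstoUniformlyOn_of_tendsto ?_ fun z _ => hf z
    obtain ⟨C, hC⟩ := hK.exists_bound_of_continuousOn hnorm.continuousOn
    rw [Metric.uniformCauchySeqOn_iff]
    intro ε hε
    obtain ⟨N, hN⟩ := Metric.cauchySeq_iff.1 hcau (ε / (|C| + 1)) (by positivity)
    refine ⟨N, fun m hm n hn z hz => (hbound _ _ z).trans_lt ?_⟩
    have h1 := hN m hm n hn
    rw [lt_div_iff₀ (by positivity)] at h1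
    have h2 := (hC z hz).trans (le_abs_self C)
    rw [norm_norm] at h2
    nlinarith [dist_nonneg (x := u m) (y := u n), norm_nonneg (R z)]
  have hfd : Differentiable ℂ f := differentiableOn_univ.1 <|
    hloc.differentiableOn
      (Filter.Eventually.of_forall fun n => (u n).differentiable.differentiableOn) isOpen_univ
  have hlim := Lp.cauchy_tendsto_of_tendsto (μ := μ) (p := 2)
    (fun n => (u n).memLp.1) f (B := fun n => ENNReal.ofReal ((1 / 2 : ℝ) ^ n))
    (by
      rw [← ENNReal.ofReal_tsum_of_nonneg (fun n => by positivity) summable_geometric_two]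
      exact ENNReal.ofReal_ne_top)
    (fun N n m hn hm => by
      have h := eLpNorm_eq (u n - u m)
      rw [show (((u n - u m : EntireL2 μ)) : ℂ → ℂ) = (u n : ℂ → ℂ) - (u m : ℂ → ℂ) from rfl] at h
      rw [h, ENNReal.ofReal_lt_ofReal_iff (by positivity), ← dist_eq_norm]
      exact hu N n m hn hm)
    (Filter.Eventually.of_forall hf)
  have hmem : MemLp f 2 μ := Lp.memLp_of_cauchy_tendsto (by norm_num) (fun n => (u n).memLp) f
    hfd.continuous.aestronglyMeasurable hlim
  refine ⟨mk f hfd hmem, ?_⟩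
  rw [tendsto_iff_norm_sub_tendsto_zero]
  have := (ENNReal.tendsto_toReal ENNReal.zero_ne_top).comp hlim
  refine this.congr fun n => ?_
  have h := eLpNorm_eq (u n - mk f hfd hmem)
  rw [show (((u n - mk f hfd hmem : EntireL2 μ)) : ℂ → ℂ) = (u n : ℂ → ℂ) - f from rfl] at h
  simp only [Function.comp, h, ENNReal.toReal_ofReal (norm_nonneg _)]

end EntireL2

/-! ### Gaussians in $w,\bar w$ and the two weights -/

/-- Since `α` is real and multiplies $w^2+\bar w^2$, there is no $xy$ term; the integral splits into
two one-dimensional Gaussians with rates $r\mp2\alpha$. -/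
theorem gaussian_exponent_eq_re_im (α r : ℝ) (a b k w : ℂ) :
    α * (w ^ 2 + conj w ^ 2) + a * w + b * conj w - r * (w * conj w) + k =
      -((r - 2 * α : ℝ) : ℂ) * w.re ^ 2 + (a + b) * w.re +
        (-((r + 2 * α : ℝ) : ℂ) * w.im ^ 2 + (Complex.I * (a - b)) * w.im) + k := by
  have h1 : w = w.re + w.im * Complex.I := (Complex.re_add_im w).symm
  have h2 : conj w = w.re - w.im * Complex.I := by
    conv_lhs => rw [h1]
    simp only [map_add, map_mul, Complex.conj_ofReal, Complex.conj_I]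
    ring
  rw [h2]
  generalize w.re = x at *
  generalize w.im = y at *
  rw [h1]
  push_cast
  linear_combination (2 * α * y ^ 2 + r * y ^ 2 : ℂ) * Complex.I_sq

theorem integrable_cexp_gaussian_conj {α r : ℝ} (h1 : 2 * α < r) (h2 : -(2 * α) < r) (a b k : ℂ) :
    Integrable fun w : ℂ =>
      Complex.exp (α * (w ^ 2 + conj w ^ 2) + a * w + b * conj w - r * (w * conj w) + k) := by
  simp only [gaussian_exponent_eq_re_im]
  exact integrable_cexp_gaussian (by linarith) (by linarith) _ _ _

theorem integral_cexp_gaussian_conj {α r : ℝ} (h1 : 2 * α < r) (h2 : -(2 * α) < r) (a b k : ℂ) :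
    ∫ w : ℂ, Complex.exp (α * (w ^ 2 + conj w ^ 2) + a * w + b * conj w - r * (w * conj w) + k) =
      (Real.pi / √((r - 2 * α) * (r + 2 * α)) : ℝ) *
        Complex.exp ((a + b) ^ 2 / (4 * (r - 2 * α)) - (a - b) ^ 2 / (4 * (r + 2 * α)) + k) := by
  simp only [gaussian_exponent_eq_re_im]
  rw [integral_cexp_gaussian (by linarith) (by linarith), mul_pow, Complex.I_sq]
  push_cast
  congr 2
  ring

/-- The weight is $|e^{\alpha w^2}|^2e^{-r|w|^2}$ with $\alpha=(s^{-1}+s)/4$, $r=(s^{-1}-s)/2$.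
Multiplication by $e^{\alpha w^2}$ therefore reduces $\mathcal X^s_{\rm hol}$ to a rescaled Bargmann
space. -/
theorem weightX_eq_cexp (s : ℝ) (w : ℂ) :
    (Real.exp (s * w.re ^ 2 - 1 / s * w.im ^ 2) : ℂ) =
      Complex.exp (((s⁻¹ + s) / 4 : ℝ) * (w ^ 2 + conj w ^ 2) -
        ((s⁻¹ - s) / 2 : ℝ) * (w * conj w)) := by
  have h := gaussian_exponent_eq_re_im ((s⁻¹ + s) / 4) ((s⁻¹ - s) / 2) 0 0 0 w
  simp only [zero_mul, add_zero, mul_zero, sub_zero] at h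
  rw [h, Complex.ofReal_exp]
  congr 1
  push_cast
  ring

theorem integrable_measureX_iff {s : ℝ} {f : ℂ → ℂ} : Integrable f (measureX s) ↔
    Integrable fun w => f w * Complex.exp (((s⁻¹ + s) / 4 : ℝ) * (w ^ 2 + conj w ^ 2) -
        ((s⁻¹ - s) / 2 : ℝ) * (w * conj w)) := by
  simp only [← weightX_eq_cexp]
  exact integrable_withDensity_ofReal_iff (by fun_prop) fun z => (Real.exp_pos _).le

theorem integral_measureX (s : ℝ) (f : ℂ → ℂ) : ∫ w, f w ∂(measureX s) =
    ∫ w, f w * Complex.exp (((s⁻¹ + s) / 4 : ℝ) * (w ^ 2 + conj w ^ 2) -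
        ((s⁻¹ - s) / 2 : ℝ) * (w * conj w)) := by
  simp only [← weightX_eq_cexp]
  exact integral_withDensity_ofReal (by fun_prop) (fun z => (Real.exp_pos _).le) f

theorem integrable_bargmannMeasure_iff {f : ℂ → ℂ} : Integrable f bargmannMeasure ↔
    Integrable fun w => f w * (Real.exp (-1 * ‖w‖ ^ 2) : ℂ) := by
  rw [bargmannMeasure, integrable_withDensity_ofReal_iff (by fun_prop) fun z => by positivity]
  have hpi : (Real.pi⁻¹ : ℂ) ≠ 0 := by simp [Real.pi_ne_zero]
  rw [← integrable_const_mul_iff (isUnit_iff_ne_zero.2 hpi) fun w : ℂ =>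
    f w * (Real.exp (-1 * ‖w‖ ^ 2) : ℂ)]
  refine integrable_congr (Filter.Eventually.of_forall fun w => ?_)
  simp only [neg_one_mul]
  push_cast
  ring

theorem integral_bargmannMeasure (f : ℂ → ℂ) : ∫ w, f w ∂bargmannMeasure =
    Real.pi⁻¹ * ∫ w, f w * (Real.exp (-1 * ‖w‖ ^ 2) : ℂ) := by
  rw [bargmannMeasure, integral_withDensity_ofReal (by fun_prop) (fun z => by positivity),
    ← integral_const_mul]
  congr 1
  funext w
  simp only [neg_one_mul]
  push_cast
  ring

theorem weightBargmann_eq_cexp (w : ℂ) :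
    (Real.exp (-1 * ‖w‖ ^ 2) : ℂ) = Complex.exp (-(w * conj w)) := by
  rw [Complex.mul_conj']
  simp

theorem conj_kernelA (s : ℝ) (z v : ℂ) :
    conj (kernelA s z v) = kernelA s (conj z) (conj v) := by
  simp only [kernelA, map_mul, ← Complex.exp_conj, map_sub, map_add, map_div₀, map_pow,
    Complex.conj_ofReal, map_ofNat]

theorem epsilonOf_pos {s : ℝ} (hs0 : 0 < s) (hs1 : s < 1) : 0 < epsilonOf s :=
  div_pos (by linarith) (by linarith)

theorem epsilonOf_lt_one {s : ℝ} (hs0 : 0 < s) : epsilonOf s < 1 := by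
  rw [epsilonOf, div_lt_one (by linarith)]
  linarith

theorem differentiable_kernelA_left (s : ℝ) (v : ℂ) : Differentiable ℂ fun z => kernelA s z v := by
  unfold kernelA
  fun_prop

theorem differentiable_kernelA_right (s : ℝ) (z : ℂ) : Differentiable ℂ (kernelA s z) := by
  unfold kernelA
  fun_prop

/-! ### Kernels and their square integrability -/

/-- The reproducing kernel of the Bargmann space. -/
noncomputable def kernelBargmann (z w : ℂ) : ℂ := Complex.exp (conj z * w)

/-- The reproducing kernel of the space `X^s_hol`. -/
noncomputable def kernelX (s : ℝ) (z w : ℂ) : ℂ :=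
  ((s⁻¹ - s) / (2 * Real.pi) : ℝ) * Complex.exp (((s⁻¹ - s) / 2 : ℝ) * (conj z * w) -
    ((s⁻¹ + s) / 4 : ℝ) * (w ^ 2 + conj z ^ 2))

theorem memLp_kernelBargmann (z : ℂ) : MemLp (kernelBargmann z) 2 bargmannMeasure := by
  refine memLp_two_of_integrable_conj_mul_self (by unfold kernelBargmann; fun_prop) ?_
  rw [integrable_bargmannMeasure_iff]
  refine (integrable_cexp_gaussian_conj (α := 0) (r := 1) (by simp) (by simp) (conj z) z 0).congr
    (Filter.Eventually.of_forall fun w => ?_)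
  simp only [weightBargmann_eq_cexp, kernelBargmann, ← Complex.exp_conj, ← Complex.exp_add]
  congr 1
  simp
  ring

theorem memLp_kernelX {s : ℝ} (hs0 : 0 < s) (hs1 : s < 1) (z : ℂ) :
    MemLp (kernelX s z) 2 (measureX s) := by
  refine memLp_two_of_integrable_conj_mul_self (by unfold kernelX; fun_prop) ?_
  have hr : 0 < (s⁻¹ - s) / 2 := by
    have := (one_lt_inv₀ hs0).2 hs1
    linarith
  rw [integrable_measureX_iff]
  refine ((integrable_cexp_gaussian_conj (α := 0) (r := (s⁻¹ - s) / 2) (by linarith) (by linarith)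
    (((s⁻¹ - s) / 2 : ℝ) * conj z) (((s⁻¹ - s) / 2 : ℝ) * z)
    (-((s⁻¹ + s) / 4 : ℝ) * (z ^ 2 + conj z ^ 2))).const_mul
    (((s⁻¹ - s) / (2 * Real.pi) : ℝ) ^ 2 : ℂ)).congr
    (Filter.Eventually.of_forall fun w => ?_)
  simp only [kernelX, map_mul, Complex.conj_ofReal, ← Complex.exp_conj]
  rw [mul_mul_mul_comm, ← Complex.exp_add, mul_assoc (_ * _) (Complex.exp _) (Complex.exp _),
    ← Complex.exp_add, ← sq]
  congr 2
  simp only [map_sub, map_mul, map_add, map_pow, Complex.conj_ofReal, Complex.conj_conj]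
  push_cast
  ring

theorem memLp_kernelA_left {s : ℝ} (hs0 : 0 < s) (hs1 : s < 1) (v : ℂ) :
    MemLp (fun z => kernelA s z v) 2 bargmannMeasure := by
  refine memLp_two_of_integrable_conj_mul_self (differentiable_kernelA_left s v).continuous ?_
  have h0 := epsilonOf_pos hs0 hs1
  have h1 := epsilonOf_lt_one hs0
  rw [integrable_bargmannMeasure_iff]
  refine ((integrable_cexp_gaussian_conj (α := -epsilonOf s / 2) (r := 1) (by linarith)
    (by linarith) ((√(2 * epsilonOf s) : ℂ) * v) ((√(2 * epsilonOf s) : ℂ) * conj v)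
    (-(v ^ 2 + conj v ^ 2) / 2)).const_mul
    ((√((1 - s) / (Real.pi * √s)) : ℂ) ^ 2)).congr
    (Filter.Eventually.of_forall fun z => ?_)
  simp only [weightBargmann_eq_cexp, conj_kernelA]
  simp only [kernelA]
  rw [mul_mul_mul_comm, ← Complex.exp_add, mul_assoc (_ * _) (Complex.exp _) (Complex.exp _),
    ← Complex.exp_add, ← sq]
  congr 2
  push_cast
  ring

/-- The shift $-1/2$ comes from the factor $e^{-v^2/2}$ of $A$. The two rates are $1-s$ and
$(1-s)/s$. -/
theorem gaussianX_bounds {s : ℝ} (hs0 : 0 < s) (hs1 : s < 1) :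
    2 * ((s⁻¹ + s) / 4 - 1 / 2) < (s⁻¹ - s) / 2 ∧
      -(2 * ((s⁻¹ + s) / 4 - 1 / 2)) < (s⁻¹ - s) / 2 := by
  have := (one_lt_inv₀ hs0).2 hs1
  constructor <;> linarith

theorem memLp_kernelA_right {s : ℝ} (hs0 : 0 < s) (hs1 : s < 1) (z : ℂ) :
    MemLp (kernelA s z) 2 (measureX s) := by
  refine memLp_two_of_integrable_conj_mul_self (differentiable_kernelA_right s z).continuous ?_
  obtain ⟨h1, h2⟩ := gaussianX_bounds hs0 hs1
  rw [integrable_measureX_iff]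
  refine ((integrable_cexp_gaussian_conj h1 h2 ((√(2 * epsilonOf s) : ℂ) * z)
    ((√(2 * epsilonOf s) : ℂ) * conj z) (-epsilonOf s * (z ^ 2 + conj z ^ 2) / 2)).const_mul
    ((√((1 - s) / (Real.pi * √s)) : ℂ) ^ 2)).congr
    (Filter.Eventually.of_forall fun w => ?_)
  simp only [conj_kernelA]
  simp only [kernelA]
  rw [mul_mul_mul_comm, ← Complex.exp_add, mul_assoc (_ * _) (Complex.exp _) (Complex.exp _),
    ← Complex.exp_add, ← sq]
  congr 2
  push_cast
  ring

/-! ### The two Gram integrals -/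

theorem sq_sqrt_two_mul_epsilonOf {s : ℝ} (hs0 : 0 < s) (hs1 : s < 1) :
    (√(2 * epsilonOf s) : ℂ) ^ 2 = 2 * ((1 - s) / (1 + s)) := by
  have h0 := epsilonOf_pos hs0 hs1
  rw [← Complex.ofReal_pow, Real.sq_sqrt (by positivity), epsilonOf]
  push_cast
  rfl

theorem sq_sqrt_kernel_const {s : ℝ} (hs0 : 0 < s) (hs1 : s < 1) :
    √((1 - s) / (Real.pi * √s)) ^ 2 = (1 - s) / (Real.pi * √s) :=
  Real.sq_sqrt (div_nonneg (by linarith) (by positivity))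

/-- The rates $1-s$ and $(1-s)/s$ give the Gaussian mass $\pi\sqrt s/(1-s)$, which the squared
constant of $A$ cancels. The choice of $\epsilon$ removes $z^2$, $z'^2$ from the exponent and leaves
$zz'$. -/
theorem integral_kernelA_mul_kernelA_measureX {s : ℝ} (hs0 : 0 < s) (hs1 : s < 1) (z z' : ℂ) :
    ∫ w, kernelA s z (conj w) * kernelA s z' w ∂(measureX s) = Complex.exp (z * z') := by
  obtain ⟨h1, h2⟩ := gaussianX_bounds hs0 hs1
  have hg := integral_cexp_gaussian_conj h1 h2 ((√(2 * epsilonOf s) : ℂ) * z')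
    ((√(2 * epsilonOf s) : ℂ) * z) (-epsilonOf s * (z ^ 2 + z' ^ 2) / 2)
  have hf (w : ℂ) : kernelA s z (conj w) * kernelA s z' w *
      Complex.exp (((s⁻¹ + s) / 4 : ℝ) * (w ^ 2 + conj w ^ 2) -
        ((s⁻¹ - s) / 2 : ℝ) * (w * conj w)) = ((√((1 - s) / (Real.pi * √s)) : ℂ) ^ 2) *
      Complex.exp (((s⁻¹ + s) / 4 - 1 / 2 : ℝ) * (w ^ 2 + conj w ^ 2) +
        (√(2 * epsilonOf s) : ℂ) * z' * w + (√(2 * epsilonOf s) : ℂ) * z * conj w -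
        ((s⁻¹ - s) / 2 : ℝ) * (w * conj w) + -epsilonOf s * (z ^ 2 + z' ^ 2) / 2) := by
    simp only [kernelA]
    rw [mul_mul_mul_comm, ← Complex.exp_add, mul_assoc (_ * _) (Complex.exp _) (Complex.exp _),
    ← Complex.exp_add, ← sq]
    congr 2
    push_cast
    ring
  have hs : (s : ℂ) ≠ 0 := by exact_mod_cast hs0.ne'
  have hs' : (1 + s : ℂ) ≠ 0 := by exact_mod_cast (by linarith : (1 + s : ℝ) ≠ 0)
  have hs'' : (1 - s : ℂ) ≠ 0 := by exact_mod_cast (by linarith : (1 - s : ℝ) ≠ 0)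
  have hr1 : (s⁻¹ - s) / 2 - 2 * ((s⁻¹ + s) / 4 - 1 / 2) = 1 - s := by ring
  have hr2 : (s⁻¹ - s) / 2 + 2 * ((s⁻¹ + s) / 4 - 1 / 2) = (1 - s) / s := by field_simp; ring
  have hc : √((1 - s) * ((1 - s) / s)) = (1 - s) / √s := by
    rw [← mul_div_assoc, Real.sqrt_div' _ hs0.le, Real.sqrt_mul_self (by linarith)]
  rw [integral_measureX]
  simp only [hf]
  rw [integral_const_mul, hg, hr1, hr2, hc, ← mul_assoc, ← Complex.ofReal_pow,
    sq_sqrt_kernel_const hs0 hs1, ← Complex.ofReal_mul,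
    show (1 - s) / (Real.pi * √s) * (Real.pi / ((1 - s) / √s)) = 1 by
      have : 1 - s ≠ 0 := by linarith
      have := Real.sqrt_pos.2 hs0
      field_simp, Complex.ofReal_one, one_mul]
  congr 1
  rw [← mul_add, ← mul_sub, mul_pow, mul_pow, sq_sqrt_two_mul_epsilonOf hs0 hs1]
  have e1 : (4 * ((((s⁻¹ - s) / 2 : ℝ) : ℂ) - 2 * (((s⁻¹ + s) / 4 - 1 / 2 : ℝ) : ℂ))) =
      4 * (1 - s) := by
    exact_mod_cast congrArg (fun x : ℝ => ((4 * x : ℝ) : ℂ)) hr1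
  have e2 : (4 * ((((s⁻¹ - s) / 2 : ℝ) : ℂ) + 2 * (((s⁻¹ + s) / 4 - 1 / 2 : ℝ) : ℂ))) =
      4 * ((1 - s) / s) := by
    exact_mod_cast congrArg (fun x : ℝ => ((4 * x : ℝ) : ℂ)) hr2
  rw [e1, e2, epsilonOf]
  push_cast
  field_simp
  ring

/-- Here the rates are $1+\epsilon=2/(1+s)$ and $1-\epsilon=2s/(1+s)$. -/
theorem integral_kernelA_mul_kernelA_bargmannMeasure {s : ℝ} (hs0 : 0 < s) (hs1 : s < 1)
    (w w' : ℂ) :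
    ∫ z, conj (kernelA s z (conj w)) * kernelA s z (conj w') ∂bargmannMeasure =
      kernelX s w' w := by
  have h0 := epsilonOf_pos hs0 hs1
  have h1 := epsilonOf_lt_one hs0
  have hg := integral_cexp_gaussian_conj (α := -epsilonOf s / 2) (r := 1) (by linarith)
    (by linarith) ((√(2 * epsilonOf s) : ℂ) * conj w') ((√(2 * epsilonOf s) : ℂ) * w)
    (-(w ^ 2 + conj w' ^ 2) / 2)
  have hf (z : ℂ) : conj (kernelA s z (conj w)) * kernelA s z (conj w') *
      Complex.exp (-(z * conj z)) = ((√((1 - s) / (Real.pi * √s)) : ℂ) ^ 2) *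
      Complex.exp ((-epsilonOf s / 2 : ℝ) * (z ^ 2 + conj z ^ 2) +
        (√(2 * epsilonOf s) : ℂ) * conj w' * z + (√(2 * epsilonOf s) : ℂ) * w * conj z -
        (1 : ℝ) * (z * conj z) + -(w ^ 2 + conj w' ^ 2) / 2) := by
    rw [conj_kernelA, Complex.conj_conj]
    simp only [kernelA]
    rw [mul_mul_mul_comm, ← Complex.exp_add, mul_assoc (_ * _) (Complex.exp _) (Complex.exp _),
    ← Complex.exp_add, ← sq]
    congr 2
    push_cast
    ring
  have hs : (s : ℂ) ≠ 0 := by exact_mod_cast hs0.ne'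
  have hs' : (1 + s : ℂ) ≠ 0 := by exact_mod_cast (by linarith : (1 + s : ℝ) ≠ 0)
  have hr1 : 1 - 2 * (-epsilonOf s / 2) = 2 / (1 + s) := by
    rw [epsilonOf]; field_simp; ring
  have hr2 : 1 + 2 * (-epsilonOf s / 2) = 2 * s / (1 + s) := by
    rw [epsilonOf]; field_simp; ring
  have hc : √(2 / (1 + s) * (2 * s / (1 + s))) = 2 * √s / (1 + s) := by
    rw [show 2 / (1 + s) * (2 * s / (1 + s)) = (2 / (1 + s)) ^ 2 * s by ring,
      Real.sqrt_mul (by positivity), Real.sqrt_sq (by positivity)]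
    ring
  rw [integral_bargmannMeasure]
  simp only [weightBargmann_eq_cexp, hf]
  rw [integral_const_mul, hg, hr1, hr2, hc, kernelX, ← mul_assoc, ← mul_assoc,
    ← Complex.ofReal_pow, sq_sqrt_kernel_const hs0 hs1,
    ← Complex.ofReal_mul, ← Complex.ofReal_mul,
    show Real.pi⁻¹ * ((1 - s) / (Real.pi * √s)) * (Real.pi / (2 * √s / (1 + s))) =
      (s⁻¹ - s) / (2 * Real.pi) by
      have h := Real.sqrt_pos.2 hs0
      have h2 := Real.sq_sqrt hs0.le
      field_simp
      rw [h2]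
      field_simp
      ring]
  congr 2
  rw [← mul_add, ← mul_sub, mul_pow, mul_pow, sq_sqrt_two_mul_epsilonOf hs0 hs1]
  have e1 : (4 * (((1 : ℝ) : ℂ) - 2 * ((-epsilonOf s / 2 : ℝ) : ℂ))) = 4 * (2 / (1 + s)) := by
    exact_mod_cast congrArg (fun x : ℝ => ((4 * x : ℝ) : ℂ)) hr1
  have e2 : (4 * (((1 : ℝ) : ℂ) + 2 * ((-epsilonOf s / 2 : ℝ) : ℂ))) = 4 * (2 * s / (1 + s)) := by
    exact_mod_cast congrArg (fun x : ℝ => ((4 * x : ℝ) : ℂ)) hr2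
  rw [e1, e2]
  push_cast
  field_simp
  ring

/-! ### Reproducing properties and completeness -/

theorem bargmann_reproducing (z : ℂ) (f : BargmannSpace) :
    inner ℂ (EntireL2.mk (kernelBargmann z) (by unfold kernelBargmann; fun_prop)
      (memLp_kernelBargmann z)) f = f z := by
  set E : BargmannSpace := EntireL2.mk (kernelBargmann z) (by unfold kernelBargmann; fun_prop)
    (memLp_kernelBargmann z) with hE
  have hi := integrable_bargmannMeasure_iff.1 (EntireL2.integrable_conj_mul E f)
  have he : (fun w => conj (E w) * f w * (Real.exp (-1 * ‖w‖ ^ 2) : ℂ)) = fun w : ℂ =>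
      Complex.exp ((1 : ℝ) * z * conj w) * f w * (Real.exp (-1 * ‖w‖ ^ 2) : ℂ) := by
    funext w
    simp [hE, EntireL2.mk_apply, kernelBargmann, ← Complex.exp_conj]
  rw [EntireL2.inner_def, integral_bargmannMeasure, he,
    integral_exp_mul_entire_mul_gaussian f.differentiable one_pos z (by rw [← he]; exact hi),
    div_one, ← mul_assoc, ← Complex.ofReal_mul, inv_mul_cancel₀ Real.pi_ne_zero,
    Complex.ofReal_one, one_mul]

theorem differentiable_kernelX (s : ℝ) (z : ℂ) : Differentiable ℂ (kernelX s z) := by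
  unfold kernelX
  fun_prop

/-- The Gaussian formula with $c=(s^{-1}-s)/2$ is applied to $g=e^{\alpha w^2}f$,
$\alpha=(s^{-1}+s)/4$; the factor $e^{-\alpha z^2}$ in `k` then turns $g(z)$ back into $f(z)$. -/
theorem x_reproducing {s : ℝ} (hs0 : 0 < s) (hs1 : s < 1) (z : ℂ) (f : XHol s) :
    inner ℂ (EntireL2.mk (kernelX s z) (differentiable_kernelX s z)
      (memLp_kernelX hs0 hs1 z)) f = f z := by
  set R : XHol s := EntireL2.mk (kernelX s z) (differentiable_kernelX s z)
    (memLp_kernelX hs0 hs1 z) with hR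
  have hc : 0 < (s⁻¹ - s) / 2 := by
    have := (one_lt_inv₀ hs0).2 hs1
    linarith
  set k : ℂ := Complex.exp (-(((s⁻¹ + s) / 4 : ℝ) * z ^ 2)) *
    ((s⁻¹ - s) / (2 * Real.pi) : ℝ) with hk
  have hk0 : k ≠ 0 := by
    refine mul_ne_zero (Complex.exp_ne_zero _) (Complex.ofReal_ne_zero.2 ?_)
    have : s⁻¹ - s ≠ 0 := by linarith
    positivity
  set g : ℂ → ℂ := fun w => Complex.exp (((s⁻¹ + s) / 4 : ℝ) * w ^ 2) * f w with hg
  have hgd : Differentiable ℂ g := by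
    have := f.differentiable
    fun_prop
  have hi := integrable_measureX_iff.1 (EntireL2.integrable_conj_mul R f)
  have he : (fun w => conj (R w) * f w *
      Complex.exp (((s⁻¹ + s) / 4 : ℝ) * (w ^ 2 + conj w ^ 2) -
        ((s⁻¹ - s) / 2 : ℝ) * (w * conj w))) = fun w : ℂ => k *
      (Complex.exp (((s⁻¹ - s) / 2 : ℝ) * z * conj w) * g w *
        (Real.exp (-((s⁻¹ - s) / 2) * ‖w‖ ^ 2) : ℂ)) := by
    funext w
    have h1 : (Real.exp (-((s⁻¹ - s) / 2) * ‖w‖ ^ 2) : ℂ) =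
        Complex.exp (-((s⁻¹ - s) / 2 : ℝ) * (w * conj w)) := by
      rw [Complex.mul_conj']
      push_cast
      rfl
    rw [h1, hR, EntireL2.mk_apply, hk, hg, kernelX]
    simp only [map_mul, Complex.conj_ofReal, ← Complex.exp_conj]
    have h2 : Complex.exp (conj (((s⁻¹ - s) / 2 : ℝ) * (conj z * w) -
          ((s⁻¹ + s) / 4 : ℝ) * (w ^ 2 + conj z ^ 2))) *
        Complex.exp (((s⁻¹ + s) / 4 : ℝ) * (w ^ 2 + conj w ^ 2) -
          ((s⁻¹ - s) / 2 : ℝ) * (w * conj w)) =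
        Complex.exp (-(((s⁻¹ + s) / 4 : ℝ) * z ^ 2)) *
          (Complex.exp (((s⁻¹ - s) / 2 : ℝ) * z * conj w) *
          (Complex.exp (((s⁻¹ + s) / 4 : ℝ) * w ^ 2) *
          Complex.exp (-((s⁻¹ - s) / 2 : ℝ) * (w * conj w)))) := by
      simp only [← Complex.exp_add]
      congr 1
      simp only [map_sub, map_mul, map_add, map_pow, Complex.conj_ofReal, Complex.conj_conj]
      ring
    linear_combination (((s⁻¹ - s) / (2 * Real.pi) : ℝ) : ℂ) * f w * h2
  rw [he, integrable_const_mul_iff (isUnit_iff_ne_zero.2 hk0)] at hi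
  rw [EntireL2.inner_def, integral_measureX, he, integral_const_mul,
    integral_exp_mul_entire_mul_gaussian hgd hc z hi, hk, hg]
  have h2 : Complex.exp (-(((s⁻¹ + s) / 4 : ℝ) * z ^ 2)) *
      Complex.exp (((s⁻¹ + s) / 4 : ℝ) * z ^ 2) = 1 := by
    rw [← Complex.exp_add, neg_add_cancel, Complex.exp_zero]
  have h3 : (((s⁻¹ - s) / (2 * Real.pi) : ℝ) : ℂ) * ((Real.pi / ((s⁻¹ - s) / 2) : ℝ) : ℂ) = 1 := by
    rw [← Complex.ofReal_mul]
    have : s⁻¹ - s ≠ 0 := by linarith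
    rw [show (s⁻¹ - s) / (2 * Real.pi) * (Real.pi / ((s⁻¹ - s) / 2)) = 1 by
      generalize s⁻¹ - s = r at this
      field_simp]
    simp
  linear_combination (((s⁻¹ - s) / (2 * Real.pi) : ℝ) : ℂ) *
    ((Real.pi / ((s⁻¹ - s) / 2) : ℝ) : ℂ) * f z * h2 + f z * h3

theorem completeSpace_bargmannSpace : CompleteSpace BargmannSpace :=
  EntireL2.completeSpace_of_reproducing _ bargmann_reproducing (by
    have := Complex.continuous_conj
    simp only [EntireL2.mk_apply, kernelBargmann]
    fun_prop)

theorem completeSpace_xHol {s : ℝ} (hs0 : 0 < s) (hs1 : s < 1) : CompleteSpace (XHol s) :=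
  EntireL2.completeSpace_of_reproducing _ (x_reproducing hs0 hs1) (by
    have := Complex.continuous_conj
    simp only [EntireL2.mk_apply, kernelX]
    fun_prop)

/-! ### The monomial basis of the Bargmann space -/

theorem memLp_basisPhi (n : ℕ) : MemLp (basisPhi n) 2 bargmannMeasure := by
  refine memLp_two_of_integrable_conj_mul_self (by unfold basisPhi; fun_prop) ?_
  rw [integrable_bargmannMeasure_iff]
  refine (((integrable_norm_pow_mul_exp_neg_sq n).ofReal (𝕜 := ℂ)).const_mul
    ((√(n ! : ℝ) : ℂ)⁻¹ ^ 2)).congr (Filter.Eventually.of_forall fun w => ?_)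
  simp only [Complex.conj_mul', basisPhi, norm_div, norm_pow, Complex.norm_real,
    Real.norm_of_nonneg (Real.sqrt_nonneg _), neg_one_mul]
  push_cast
  simp only [div_eq_mul_inv, inv_pow]
  simp
  ring

/-- The normalized monomial `z ^ n / √(n!)` in the Bargmann space. -/
noncomputable def bargmannPhi (n : ℕ) : BargmannSpace :=
  EntireL2.mk (basisPhi n) (by unfold basisPhi; fun_prop) (memLp_basisPhi n)

theorem bargmannPhi_apply (n : ℕ) (z : ℂ) : bargmannPhi n z = basisPhi n z := rfl

/-- The expansion `c` is left free so that the formula applies to a monomial, to a Taylor series and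
to the Hermite expansion of $A$. -/
theorem inner_bargmannPhi (n : ℕ) (f : BargmannSpace) {c : ℕ → ℂ}
    (hc : ∀ z, HasSum (fun k => c k * z ^ k) (f z)) :
    inner ℂ (bargmannPhi n) f = (√(n ! : ℝ) : ℂ) * c n := by
  have hi := integrable_bargmannMeasure_iff.1 (EntireL2.integrable_conj_mul (bargmannPhi n) f)
  have hn : (√(n ! : ℝ) : ℂ) ≠ 0 := by
    have : (0 : ℝ) < n ! := by positivity
    exact_mod_cast (Real.sqrt_pos.2 this).ne'
  have he : (fun w => conj (bargmannPhi n w) * f w * (Real.exp (-1 * ‖w‖ ^ 2) : ℂ)) =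
      fun w : ℂ => (√(n ! : ℝ) : ℂ)⁻¹ *
        (conj w ^ n * f w * (Real.exp (-‖w‖ ^ 2) : ℂ)) := by
    funext w
    simp only [bargmannPhi_apply, basisPhi, map_div₀, map_pow, Complex.conj_ofReal, neg_one_mul]
    ring
  rw [he, integrable_const_mul_iff (isUnit_iff_ne_zero.2 (inv_ne_zero hn))] at hi
  rw [EntireL2.inner_def, integral_bargmannMeasure, he, integral_const_mul,
    integral_conj_pow_mul_entire_mul_radial f.differentiable hc n
      (ρ := fun r => Real.exp (-r ^ 2)) (by fun_prop) hi,
    integral_norm_pow_mul_exp_neg_sq]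
  have hpi : (Real.pi : ℂ) ≠ 0 := by exact_mod_cast Real.pi_ne_zero
  have hsq : (√(n ! : ℝ) : ℂ) ^ 2 = (n ! : ℂ) := by
    rw [← Complex.ofReal_pow, Real.sq_sqrt (by positivity)]
    simp
  rw [Complex.ofReal_mul, Complex.ofReal_natCast, Complex.ofReal_inv, ← hsq]
  field_simp

theorem orthonormal_bargmannPhi : Orthonormal ℂ bargmannPhi := by
  rw [orthonormal_iff_ite]
  intro n m
  rw [inner_bargmannPhi n (bargmannPhi m) (c := fun k => if k = m then (√(m ! : ℝ) : ℂ)⁻¹ else 0)]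
  · split_ifs with h
    · subst h
      refine mul_inv_cancel₀ ?_
      have : (0 : ℝ) < n ! := by positivity
      exact_mod_cast (Real.sqrt_pos.2 this).ne'
    · simp
  · intro z
    have := hasSum_ite_eq m (bargmannPhi m z)
    refine this.congr_fun fun k => ?_
    split_ifs with h
    · subst h
      simp [bargmannPhi_apply, basisPhi]
      ring
    · simp

theorem span_bargmannPhi_orthogonal :
    (Submodule.span ℂ (Set.range bargmannPhi))ᗮ = ⊥ := by
  rw [Submodule.eq_bot_iff]
  intro f hf
  have hs (z : ℂ) := Complex.hasSum_taylorSeries_of_entire f.differentiable 0 z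
  have hs' (z : ℂ) : HasSum (fun k => ((k ! : ℂ)⁻¹ * iteratedDeriv k f 0) * z ^ k) (f z) :=
    (hs z).congr_fun fun k => by simp only [smul_eq_mul, sub_zero]; ring
  have h0 (n : ℕ) : (n ! : ℂ)⁻¹ * iteratedDeriv n f 0 = 0 := by
    have h := (Submodule.mem_orthogonal _ _).1 hf _ (Submodule.subset_span ⟨n, rfl⟩)
    rw [inner_bargmannPhi n f hs'] at h
    refine (mul_eq_zero.1 h).resolve_left ?_
    have : (0 : ℝ) < n ! := by positivity
    exact_mod_cast (Real.sqrt_pos.2 this).ne'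
  refine EntireL2.ext_fun fun z => ?_
  have := hs' z
  simp only [h0, zero_mul] at this
  exact this.unique hasSum_zero

/-! ### Hermite expansion of the kernel -/

/-- The generating function of the Hermite polynomials. -/
theorem hasSum_hermiteH (w t : ℂ) :
    HasSum (fun n => hermiteH n w / (n ! : ℂ) * t ^ n) (Complex.exp (2 * w * t - t ^ 2)) := by
  set a : ℕ → ℂ := fun k => (2 * w * t) ^ k / (k ! : ℂ) with ha
  -- The series of $e^{-t^2}$ is padded with zeros at odd indices, so that the Cauchy product is
  -- graded by the power of $t$.
  set b : ℕ → ℂ := fun j => if Even j then (-t ^ 2) ^ (j / 2) / ((j / 2) ! : ℂ) else 0 with hb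
  have hexp (x : ℂ) : HasSum (fun k => x ^ k / (k ! : ℂ)) (Complex.exp x) := by
    rw [Complex.exp_eq_exp_ℂ]
    exact NormedSpace.expSeries_div_hasSum_exp x
  have hA : HasSum a (Complex.exp (2 * w * t)) := hexp _
  have hB : HasSum b (Complex.exp (-t ^ 2)) := by
    have hinj : Function.Injective fun m : ℕ => 2 * m := fun x y h => by simpa using h
    rw [← hinj.hasSum_iff]
    · refine (hexp (-t ^ 2)).congr_fun fun m => ?_
      simp [hb]
    · intro j hj
      have : ¬ Even j := fun ⟨r, hr⟩ => hj ⟨r, by simp only; omega⟩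
      simp [hb, this]
  have h := hasSum_sum_range_mul_of_summable_norm hB.summable.norm hA.summable.norm
  rw [hA.tsum_eq, hB.tsum_eq, ← Complex.exp_add] at h
  rw [show 2 * w * t - t ^ 2 = -t ^ 2 + 2 * w * t by ring]
  refine h.congr_fun fun n => ?_
  have hsub : (Finset.range (n / 2 + 1)).image (fun m => 2 * m) ⊆ Finset.range (n + 1) := by
    intro j hj
    simp only [Finset.mem_image, Finset.mem_range] at hj ⊢
    omega
  rw [← Finset.sum_subset hsub, Finset.sum_image (fun x _ y _ h => by simpa using h), hermiteH,
    mul_div_cancel_left₀ _ (by exact_mod_cast n.factorial_ne_zero), Finset.sum_mul]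
  · refine Finset.sum_congr rfl fun m hm => ?_
    have hm' : 2 * m ≤ n := by
      simp only [Finset.mem_range] at hm
      omega
    simp only [ha, hb, even_two_mul, if_true, Nat.mul_div_cancel_left m two_pos]
    have ht : t ^ n = t ^ (2 * m) * t ^ (n - 2 * m) := by
      rw [← pow_add]
      congr 1
      omega
    rw [ht, mul_pow (2 * w) t, neg_pow (t ^ 2), ← pow_mul]
    ring
  · intro j hj hj'
    have : ¬ Even j := by
      rintro ⟨r, hr⟩
      refine hj' (Finset.mem_image.2 ⟨r, ?_, by omega⟩)
      simp only [Finset.mem_range] at hj ⊢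
      omega
    simp [hb, this]

/-- Because $\epsilon/2$ is the inverse of $2(1+s)/(1-s)$, the normalization splits into the
constant of $A$, a power absorbed by rescaling $z$, and $1/\sqrt{n!}$. -/
theorem sqrt_hermiteB {s : ℝ} (hs0 : 0 < s) (hs1 : s < 1) (n : ℕ) :
    (√(hermiteB s n))⁻¹ =
      √((1 - s) / (Real.pi * √s)) * √(epsilonOf s / 2) ^ n / √(n ! : ℝ) := by
  have h1 : 0 < 1 - s := by linarith
  have hb : hermiteB s n =
      ((1 - s) / (Real.pi * √s))⁻¹ * ((epsilonOf s / 2)⁻¹) ^ n * (n ! : ℝ) := by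
    rw [hermiteB, epsilonOf, inv_div, inv_div, ← mul_div_assoc, div_div_eq_mul_div]
  have he : 0 < epsilonOf s / 2 := half_pos (epsilonOf_pos hs0 hs1)
  rw [hb, Real.sqrt_mul (by positivity), Real.sqrt_mul (by positivity), Real.sqrt_inv,
    show (epsilonOf s / 2)⁻¹ ^ n = ((√(epsilonOf s / 2) ^ n)⁻¹) ^ 2 by
      rw [inv_pow, inv_pow, ← pow_mul, mul_comm n, pow_mul, Real.sq_sqrt he.le],
    Real.sqrt_sq (by positivity), mul_inv, mul_inv, inv_inv, inv_inv, ← div_eq_mul_inv]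

/-- Put $t=z\sqrt{\epsilon/2}$ in the generating function: $2vt=\sqrt{2\epsilon}\,zv$ and
$t^2=\epsilon z^2/2$. -/
theorem hasSum_kernelA {s : ℝ} (hs0 : 0 < s) (hs1 : s < 1) (v z : ℂ) :
    HasSum (fun n => basisH s n v / (√(n ! : ℝ) : ℂ) * z ^ n) (kernelA s z v) := by
  have h := (hasSum_hermiteH v (z * (√(epsilonOf s / 2) : ℂ))).mul_left
    ((√((1 - s) / (Real.pi * √s)) : ℂ) * Complex.exp (-v ^ 2 / 2))
  have he := epsilonOf_pos hs0 hs1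
  have hk : kernelA s z v = (√((1 - s) / (Real.pi * √s)) : ℂ) * Complex.exp (-v ^ 2 / 2) *
      Complex.exp (2 * v * (z * (√(epsilonOf s / 2) : ℂ)) -
        (z * (√(epsilonOf s / 2) : ℂ)) ^ 2) := by
    have h1 : (√(epsilonOf s / 2) : ℂ) ^ 2 = epsilonOf s / 2 := by
      rw [← Complex.ofReal_pow, Real.sq_sqrt (by positivity)]
      simp
    have h2 : (√(2 * epsilonOf s) : ℂ) = 2 * (√(epsilonOf s / 2) : ℂ) := by
      rw [show 2 * epsilonOf s = 2 ^ 2 * (epsilonOf s / 2) by ring,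
        Real.sqrt_mul (by positivity), Real.sqrt_sq (by positivity)]
      push_cast
      rfl
    rw [kernelA, mul_assoc _ (Complex.exp _) (Complex.exp _), ← Complex.exp_add, mul_pow, h1, h2]
    congr 2
    ring
  rw [hk]
  refine h.congr_fun fun n => ?_
  have hs : ((√(hermiteB s n) : ℝ) : ℂ)⁻¹ = (√((1 - s) / (Real.pi * √s)) : ℂ) *
      (√(epsilonOf s / 2) : ℂ) ^ n / (√(n ! : ℝ) : ℂ) := by
    rw [← Complex.ofReal_inv, sqrt_hermiteB hs0 hs1]
    push_cast
    rfl
  have hn : (n ! : ℂ) = (√(n ! : ℝ) : ℂ) * (√(n ! : ℝ) : ℂ) := by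
    rw [← Complex.ofReal_mul, Real.mul_self_sqrt (by positivity)]
    simp
  rw [basisH, div_eq_mul_inv (hermiteH n v), hs, hn, mul_pow]
  ring

theorem conj_basisH (s : ℝ) (n : ℕ) (w : ℂ) : conj (basisH s n w) = basisH s n (conj w) := by
  simp only [basisH, hermiteH, map_mul, map_div₀, map_sum, map_pow, map_neg, map_one, map_ofNat,
    map_natCast, Complex.conj_ofReal, ← Complex.exp_conj]

/-! ### The unitary map and its identification -/

theorem mainTheorem2 (s : ℝ) (hs0 : 0 < s) (hs1 : s < 1) :
    -- both spaces are Hilbert spaces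
    CompleteSpace (XHol s) ∧ CompleteSpace BargmannSpace ∧
    -- the integrals that define the two operators converge absolutely
    (∀ (f : XHol s) (z : ℂ), Integrable (fun w => kernelA s z (conj w) * f w) (measureX s)) ∧
    (∀ (g : BargmannSpace) (w : ℂ),
      Integrable (fun z => conj (kernelA s z (conj w)) * g z) bargmannMeasure) ∧
    ∃ (h : HilbertBasis ℕ ℂ (XHol s)) (Φ : HilbertBasis ℕ ℂ BargmannSpace)
      (U : XHol s ≃ₗᵢ[ℂ] BargmannSpace),
      (∀ (n : ℕ) (w : ℂ), h n w = basisH s n w) ∧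
      (∀ (n : ℕ) (z : ℂ), Φ n z = basisPhi n z) ∧
      -- `U` is the operator `A`, its inverse is `W`, and `A` maps the first basis to the second
      (∀ (f : XHol s) (z : ℂ), U f z = operatorA s f z) ∧
      (∀ n : ℕ, U (h n) = Φ n) ∧
      (∀ (g : BargmannSpace) (w : ℂ), U.symm g w = operatorW s g w) := by
  have := completeSpace_xHol hs0 hs1
  have := completeSpace_bargmannSpace
  let R (w : ℂ) : XHol s :=
    EntireL2.mk (kernelX s w) (differentiable_kernelX s w) (memLp_kernelX hs0 hs1 w)
  let E (z : ℂ) : BargmannSpace :=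
    EntireL2.mk (kernelBargmann z) (by unfold kernelBargmann; fun_prop) (memLp_kernelBargmann z)
  let Q (w : ℂ) : BargmannSpace := EntireL2.mk (fun z => kernelA s z (conj w))
    (differentiable_kernelA_left s _) (memLp_kernelA_left hs0 hs1 _)
  -- The inner product conjugates its first argument, hence the `conj z`.
  let K (z : ℂ) : XHol s := EntireL2.mk (kernelA s (conj z))
    (differentiable_kernelA_right s _) (memLp_kernelA_right hs0 hs1 _)
  have hR (w : ℂ) (f : XHol s) : inner ℂ (R w) f = f w := x_reproducing hs0 hs1 w f
  have hE (z : ℂ) (g : BargmannSpace) : inner ℂ (E z) g = g z := bargmann_reproducing z g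
  have hKc (z w : ℂ) : conj (K z w) = kernelA s z (conj w) := by
    simp only [K, EntireL2.mk_apply, conj_kernelA, Complex.conj_conj]
  have hK (z : ℂ) (f : XHol s) : inner ℂ (K z) f = operatorA s f z := by
    simp only [EntireL2.inner_def, hKc, operatorA]
  have hQ (w : ℂ) (g : BargmannSpace) : inner ℂ (Q w) g = operatorW s g w := rfl
  have hQQ (w w' : ℂ) : inner ℂ (Q w) (Q w') = inner ℂ (R w) (R w') := by
    rw [hR]
    exact integral_kernelA_mul_kernelA_bargmannMeasure hs0 hs1 w w'
  have hEE (z z' : ℂ) : inner ℂ (E z) (E z') = inner ℂ (K z) (K z') := by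
    rw [hE, hK]
    refine Eq.trans ?_ (integral_kernelA_mul_kernelA_measureX hs0 hs1 z (conj z')).symm
    simp only [E, EntireL2.mk_apply, kernelBargmann, mul_comm]
  -- Both sides equal $A(z,\bar w)$ by point evaluation.
  have hEQ (z w : ℂ) : inner ℂ (E z) (Q w) = inner ℂ (K z) (R w) := by
    rw [hE, ← inner_conj_symm, hR, hKc]
    rfl
  have hQE (w z : ℂ) : inner ℂ (Q w) (E z) = inner ℂ (R w) (K z) := by
    rw [← inner_conj_symm, hEQ, inner_conj_symm]
  -- Totality already follows from `R` and `E`; adjoining `K` and `Q` fixes the values of `U` that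
  -- express it and its inverse as integrals.
  obtain ⟨U, hU⟩ := exists_linearIsometryEquiv_of_gram_eq (Sum.elim R K) (Sum.elim Q E)
    (fun f hf => EntireL2.ext_fun fun w => by
      rw [← hR w f]
      exact hf (Sum.inl w))
    (fun g hg => EntireL2.ext_fun fun z => by
      rw [← hE z g]
      exact hg (Sum.inr z))
    (by
      rintro (w | z) (w' | z')
      · exact hQQ w w'
      · exact hQE w z'
      · exact hEQ z w'
      · exact hEE z z')
  have hUR (w : ℂ) : U (R w) = Q w := hU (Sum.inl w)
  have hUK (z : ℂ) : U (K z) = E z := hU (Sum.inr z)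
  have hUA (f : XHol s) (z : ℂ) : U f z = operatorA s f z := by
    rw [← hE, ← hUK, U.inner_map_map, hK]
  have hUW (g : BargmannSpace) (w : ℂ) : U.symm g w = operatorW s g w := by
    rw [← hR, ← hQ, ← hUR, ← U.inner_map_map, U.apply_symm_apply]
  let Φ : HilbertBasis ℕ ℂ BargmannSpace :=
    HilbertBasis.mkOfOrthogonalEqBot orthonormal_bargmannPhi span_bargmannPhi_orthogonal
  have hΦ (n : ℕ) : Φ n = bargmannPhi n := by
    simp only [Φ, HilbertBasis.coe_mkOfOrthogonalEqBot]
  let h : HilbertBasis ℕ ℂ (XHol s) := HilbertBasis.ofRepr (U.trans Φ.repr)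
  have hh (n : ℕ) : h n = U.symm (Φ n) := rfl
  refine ⟨inferInstance, inferInstance, fun f z => ?_,
    fun g w => EntireL2.integrable_conj_mul (Q w) g, h, Φ, U, fun n w => ?_, fun n z => ?_, hUA,
    fun n => ?_, hUW⟩
  · simpa only [hKc] using EntireL2.integrable_conj_mul (K z) f
  -- $(U^{-1}\Phi_n)(w)=\overline{\langle\Phi_n,Q_w\rangle}$ is read off from the $n$th coefficient
  -- of $A(\cdot,\bar w)$.
  · rw [hh, hUW, ← hQ, hΦ, ← inner_conj_symm,
      inner_bargmannPhi n (Q w) fun z => hasSum_kernelA hs0 hs1 (conj w) z, map_mul, map_div₀,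
      conj_basisH, Complex.conj_conj, Complex.conj_ofReal]
    refine mul_div_cancel₀ _ ?_
    have : (0 : ℝ) < n ! := by positivity
    exact_mod_cast (Real.sqrt_pos.2 this).ne'
  · rw [hΦ, bargmannPhi_apply]
  · rw [hh, U.apply_symm_apply]
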